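/- Let $\Sigma$ be an alphabet with $q$ symbols. For $n\ge 2$ and $\mathbf u,\mathbf v\in\Sigma^n$ (coordinates indexed by $\mathbb Z/n\mathbb Z$), the pair-distance is $$D_p(\mathbf u,\mathbf v)=|\{i\in\mathbb Z/n\mathbb Z : (u_i,u_{i+1})\neq (v_i,v_{i+1})\}|.$$ For $2\le d\le n$, an MDS $(n,d)_q$-symbol-pair code is a set $\mathcal C\subseteq\Sigma^n$ with $\min\{D_p(\mathbf u,\mathbf v):\mathbf u,\mathbf v\in\mathcal C,\ \mathbf u\ne\mathbf v\}=d$ and $|\mathcal C|=q^{\,n-d+2}$. For a positive integer $m$ put $$M(m)=\begin{cases}2\lfloor m^2/8\rfloor,& m\text{ even},\\ 2\lfloor (m-1)^2/8\rfloor+1,& m\text{ odd}.\end{cases}$$ Let $q\ge 5$ be a prime power and let $n\ge 4$. Then an MDS $(n,n-2)_q$-symbol-pair code exists (over every alphabet with $q$ symbols) in each of the following cases: (i) $q$ is odd, and either $n\le M(q)+1$, or else $n$ is even, $M(q)+1\le n\le M(q+1)$ and $n\ne M(q+1)-2$; (ii) $q$ is even, $n\le q^2/4+1$ and $n\ne q^2/4-1$.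 -/

import Mathlib

/-- The symbol-pair read vector `((u₀,u₁), (u₁,u₂), …, (uₙ₋₁,u₀))` of a word `u` of length `n`;
coordinates are indexed by `ℤ/nℤ`, so `i + 1` is read cyclically. -/
def symbolPairRead {n : ℕ} {α : Type*} (u : ZMod n → α) : ZMod n → α × α :=
  fun i => (u i, u (i + 1))

/-- The pair-distance of two words: the Hamming distance of their symbol-pair read vectors
(used for `n ≥ 1`, where the set of coordinates is finite). -/
noncomputable def pairDist {n : ℕ} {α : Type*} (u v : ZMod n → α) : ℕ :=
  {i : ZMod n | symbolPairRead u i ≠ symbolPairRead v i}.ncard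

/-- The code `C` has pair-distance `d`: `d` is the minimum (attained) of the pair-distances of two
distinct codewords. -/
def HasPairDistance {n : ℕ} {α : Type*} (C : Set (ZMod n → α)) (d : ℕ) : Prop :=
  IsLeast {k : ℕ | ∃ u ∈ C, ∃ v ∈ C, u ≠ v ∧ k = pairDist u v} d

/-- `C` is an MDS `(n,d)_q`-symbol-pair code over the alphabet `α` with `q` symbols: it has
pair-distance `d` and meets the Singleton-type bound, i.e. has exactly `q ^ (n - d + 2)` words. -/
structure IsMDSSymbolPairCode {n : ℕ} {α : Type*} (C : Set (ZMod n → α)) (d : ℕ) : Prop where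
  two_le : 2 ≤ d
  le_length : d ≤ n
  pairDistance : HasPairDistance C d
  size : C.ncard = Nat.card α ^ (n - d + 2)

/-- `M(n) = 2⌊n²/8⌋` for even `n` and `M(n) = 2⌊(n-1)²/8⌋ + 1` for odd `n`. -/
def eulerianSizeBound (n : ℕ) : ℕ :=
  if Even n then 2 * (n ^ 2 / 8) else 2 * ((n - 1) ^ 2 / 8) + 1

/-!
Take the extended Reed–Solomon code of dimension `4` over the field `F` with `q` elements: its words
are indexed by the `q + 1` points of the projective line, and two distinct words agree in at most
three points. Read each word along a cyclic sequence `w` of `n` points. Two of the resulting words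
of length `n` agree in the pair of positions `(i, i + 1)` exactly when both `w i` and `w (i + 1)`
lie in the set where the original words agree. So if a set of at most three points contains at most
two of the steps of `w`, the pair-distance of distinct words is at least `n - 2`
(`exists_isMDSSymbolPairCode_of_sparseOnTriples`); equality holds for two words that agree at
`w 0`, `w 1`, `w 2`. The steps of `w` have this property when `w` runs through a closed trail in a
triangle-free graph (`sparseOnTriples_getVert`).

It remains to find closed trails of length `n` in triangle-free graphs with at most `q + 1`
vertices. A `2A × 2B` complete bipartite graph splits into `A * B` blocks, each a `4`-cycle, which
can be spliced one after another to a short initial trail (`hasBipartiteTrail_add_blocks`).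

* Initial trails within the graph are a `4`-cycle, giving the lengths `4, 8, …, 4AB`, and a trail of
  length `10` filling part of four blocks, giving the lengths `10, 14, …, 4AB - 6`. For length `6`
  there is a `6`-cycle with three vertices in either part.
* One more vertex allows a `6`-cycle in place of two blocks, giving the lengths `6, 10, …, 4AB - 2`.
* For odd lengths, one edge of a trail of even length is subdivided by a new vertex
  (`exists_subdivided_trail`).

For odd `q` the even lengths use graphs with `q + 1` vertices and the odd lengths use graphs with
`q - 1` vertices and one or two further ones; for even `q` there are `q` vertices and at most one
further one.
-/

/-! ### Reading a Reed–Solomon code along a sequence of points -/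

open Polynomial in
/-- Evaluation of a polynomial of degree less than `4` at the points of the projective line over
`F`: its value at the point `none` at infinity is its coefficient of `X ^ 3`. -/
noncomputable def projEval (F : Type*) [Field F] : degreeLT F 4 →ₗ[F] (Option F → F) :=
  LinearMap.pi (fun x => match x with
    | none => lcoeff F 3
    | some a => leval a) ∘ₗ (degreeLT F 4).subtype

open Polynomial in
lemma projEval_none {F : Type*} [Field F] (P : degreeLT F 4) :
    projEval F P none = (P : F[X]).coeff 3 := rfl

open Polynomial in
lemma projEval_some {F : Type*} [Field F] (P : degreeLT F 4) (a : F) :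
    projEval F P (some a) = (P : F[X]).eval a := rfl

open Polynomial in
/-- A nonzero word of the extended Reed–Solomon code of dimension `4` has at most three zeros. -/
lemma card_le_three_of_projEval_eq_zero {F : Type*} [Field F] {P : degreeLT F 4} (hP : P ≠ 0)
    (S : Finset (Option F)) (hS : ∀ x ∈ S, projEval F P x = 0) : S.card ≤ 3 := by
  classical
  have hP' : (P : F[X]) ≠ 0 := by simpa using hP
  have hdeg : (P : F[X]).natDegree < 4 :=
    (natDegree_lt_iff_degree_lt hP').2 (mem_degreeLT.1 P.2)
  have hsub : S.eraseNone ⊆ (P : F[X]).roots.toFinset := by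
    intro a ha
    rw [Multiset.mem_toFinset, mem_roots hP', IsRoot.def, ← projEval_some]
    exact hS _ (Finset.mem_eraseNone.1 ha)
  have hroots : S.eraseNone.card ≤ (P : F[X]).natDegree :=
    (Finset.card_le_card hsub).trans ((Multiset.toFinset_card_le _).trans (card_roots' _))
  by_cases hnone : none ∈ S
  · have hcard := Finset.card_eraseNone_of_mem hnone
    have hcoeff : (P : F[X]).coeff 3 = 0 := by rw [← projEval_none]; exact hS _ hnone
    have hne : (P : F[X]).natDegree ≠ 3 := fun h =>
      hP' (leadingCoeff_eq_zero.1 (by rw [leadingCoeff, h, hcoeff]))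
    omega
  · have := Finset.card_eraseNone_of_not_mem hnone
    omega

/-- Three conditions do not determine a word of the extended Reed–Solomon code of dimension `4`. -/
lemma exists_projEval_eq_zero {F : Type*} [Field F] (x : Fin 3 → Option F) :
    ∃ P : Polynomial.degreeLT F 4, P ≠ 0 ∧ ∀ j, projEval F P (x j) = 0 := by
  have hker : LinearMap.ker (LinearMap.funLeft F F x ∘ₗ projEval F) ≠ ⊥ := by
    have := (Polynomial.degreeLTEquiv F 4).finiteDimensional
    refine LinearMap.ker_ne_bot_of_finrank_lt ?_
    rw [(Polynomial.degreeLTEquiv F 4).finrank_eq]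
    simp
  obtain ⟨P, hP, hP0⟩ := Submodule.exists_mem_ne_zero_of_ne_bot hker
  exact ⟨P, hP0, fun j => congrFun (LinearMap.mem_ker.1 hP) j⟩

/-- The pair-distance counts the positions `i` at which the words differ in `i` or in `i + 1`. -/
lemma pairDist_add_ncard {n : ℕ} [NeZero n] {α : Type*} (u v : ZMod n → α) :
    pairDist u v + {i | u i = v i ∧ u (i + 1) = v (i + 1)}.ncard = n := by
  have h : {i : ZMod n | symbolPairRead u i ≠ symbolPairRead v i} =
      {i | u i = v i ∧ u (i + 1) = v (i + 1)}ᶜ := by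
    ext i; simp [symbolPairRead]
  rw [pairDist, h, add_comm, Set.ncard_add_ncard_compl, Nat.card_zmod]

/-- The cyclic sequence `w` is *sparse on triples* if every set of at most three points contains
both ends of at most two of its steps `(w i, w (i + 1))`. -/
def SparseOnTriples {n : ℕ} {V : Type*} (w : ZMod n → V) : Prop :=
  ∀ S : Finset V, S.card ≤ 3 → {i | w i ∈ S ∧ w (i + 1) ∈ S}.ncard ≤ 2

lemma SparseOnTriples.comp {n : ℕ} [NeZero n] {V W : Type*} {w : ZMod n → V}
    (hw : SparseOnTriples w) {f : V → W} (hf : Set.InjOn f (Set.range w)) :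
    SparseOnTriples (f ∘ w) := by
  classical
  intro S hS
  have hfin : (Set.range w).Finite := Set.finite_range w
  let T := hfin.toFinset.filter (fun v => f v ∈ S)
  have hT : T.card ≤ S.card := by
    refine Finset.card_le_card_of_injOn f (fun v hv => (Finset.mem_filter.1 hv).2) ?_
    refine hf.mono fun v hv => ?_
    simpa using (Finset.mem_filter.1 hv).1
  refine le_trans (Set.ncard_le_ncard ?_ (Set.toFinite _)) (hw T (hT.trans hS))
  rintro i ⟨h₁, h₂⟩
  exact ⟨by simpa [T] using h₁, by simpa [T] using h₂⟩

/-- The words of the extended Reed–Solomon code of dimension `4`, read along a sequence of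
length `n` that is sparse on triples, form an MDS symbol-pair code. -/
lemma exists_isMDSSymbolPairCode_of_sparseOnTriples {F α : Type*} [Field F] [Finite F]
    (e : F ≃ α) {n : ℕ} (hn : 4 ≤ n) {w : ZMod n → Option F} (hw : SparseOnTriples w) :
    ∃ C : Set (ZMod n → α), IsMDSSymbolPairCode C (n - 2) := by
  classical
  have : NeZero n := ⟨by omega⟩
  let word : Polynomial.degreeLT F 4 → ZMod n → α := fun P i => e (projEval F P (w i))
  have hagree : ∀ P Q i, word P i = word Q i ↔ projEval F (P - Q) (w i) = 0 := by
    intro P Q i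
    simp [word, sub_eq_zero]
  have hdist : ∀ P Q, P ≠ Q → n - 2 ≤ pairDist (word P) (word Q) := by
    intro P Q hPQ
    have := Fintype.ofFinite F
    let S : Finset (Option F) := Finset.univ.filter (fun x => projEval F (P - Q) x = 0)
    have hS := hw S (card_le_three_of_projEval_eq_zero (sub_ne_zero.2 hPQ) S (by simp [S]))
    have hset : {i | w i ∈ S ∧ w (i + 1) ∈ S} =
        {i | word P i = word Q i ∧ word P (i + 1) = word Q (i + 1)} := by
      ext i
      simp only [Set.mem_ofPred_eq, hagree]
      simp [S]
    rw [hset] at hS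
    have := pairDist_add_ncard (word P) (word Q)
    omega
  have hinj : Function.Injective word := by
    intro P Q hPQ
    by_contra hne
    have h := hdist P Q hne
    rw [hPQ] at h
    have : pairDist (word Q) (word Q) = 0 := by simp [pairDist]
    omega
  refine ⟨Set.range word, by omega, by omega, ⟨?_, ?_⟩, ?_⟩
  · -- A word vanishing at the first three points of `w` attains the distance.
    obtain ⟨P, hP0, hP⟩ := exists_projEval_eq_zero ![w 0, w 1, w (1 + 1)]
    refine ⟨_, ⟨P, rfl⟩, _, ⟨0, rfl⟩, hinj.ne hP0, (hdist P 0 hP0).antisymm ?_⟩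
    have h01 : (0 : ZMod n) ≠ 1 := by
      have : Fact (1 < n) := ⟨by omega⟩
      exact zero_ne_one
    have hsub : ({0, 1} : Set (ZMod n)) ⊆
        {i | word P i = word 0 i ∧ word P (i + 1) = word 0 (i + 1)} := by
      have h0 := hP 0
      have h1 := hP 1
      have h2 := hP 2
      rintro i (rfl | rfl)
      · simp only [Set.mem_ofPred_eq, hagree, sub_zero, zero_add]
        exact ⟨h0, h1⟩
      · simp only [Set.mem_ofPred_eq, hagree, sub_zero]
        exact ⟨h1, h2⟩
    have hcard := Set.ncard_le_ncard hsub (Set.toFinite _)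
    rw [Set.ncard_pair h01] at hcard
    have := pairDist_add_ncard (word P) (word 0)
    omega
  · rintro k ⟨_, ⟨P, rfl⟩, _, ⟨Q, rfl⟩, hne, rfl⟩
    exact hdist P Q fun h => hne (h ▸ rfl)
  · have hexp : n - (n - 2) + 2 = 4 := by omega
    rw [← Set.image_univ, Set.ncard_image_of_injective _ hinj, Set.ncard_univ, hexp,
      ← Nat.card_congr e, Nat.card_congr (Polynomial.degreeLTEquiv F 4).toEquiv,
      Nat.card_fun, Nat.card_fin]

/-- An MDS symbol-pair code of length `n` exists over any alphabet with `q` symbols, `q` a prime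
power, as soon as some sequence of length `n` on at most `q + 1` points is sparse on triples. -/
lemma exists_isMDSSymbolPairCode_of_isPrimePow {q n : ℕ} (hq : IsPrimePow q) {α V : Type*}
    (hα : Nat.card α = q) (hn : 4 ≤ n) {w : ZMod n → V} (hw : SparseOnTriples w)
    {T : Finset V} (hT : ∀ i, w i ∈ T) (hTq : T.card ≤ q + 1) :
    ∃ C : Set (ZMod n → α), IsMDSSymbolPairCode C (n - 2) := by
  classical
  have : NeZero n := ⟨by omega⟩
  obtain ⟨p, k, hp, hk, rfl⟩ := (isPrimePow_nat_iff q).1 hq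
  have : Fact p.Prime := ⟨hp⟩
  let F := GaloisField p k
  have hF : Nat.card F = p ^ k := GaloisField.card p k hk.ne'
  have : Finite F := inferInstance
  have : Fintype F := Fintype.ofFinite F
  have : Finite α := Nat.finite_of_card_ne_zero (by rw [hα]; exact pow_ne_zero _ hp.ne_zero)
  obtain ⟨e⟩ := (Finite.card_eq (α := F) (β := α)).1 (hF.trans hα.symm)
  obtain ⟨g⟩ : Nonempty (T ↪ Option F) := Function.Embedding.nonempty_of_card_le (by
    rw [Fintype.card_coe, Fintype.card_option, ← Nat.card_eq_fintype_card, hF]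
    exact hTq)
  refine exists_isMDSSymbolPairCode_of_sparseOnTriples e hn
    (w := (fun v => if h : v ∈ T then g ⟨v, h⟩ else none) ∘ w) (hw.comp ?_)
  rintro _ ⟨i, rfl⟩ _ ⟨j, rfl⟩ hij
  simpa [hT] using hij

/-! ### Closed trails in triangle-free graphs -/

open SimpleGraph

/-- A graph without triangles has at most two edges on three vertices, so the vertices met by a
closed trail in it form a sequence that is sparse on triples. -/
lemma sparseOnTriples_getVert {V : Type*} {G : SimpleGraph V} (hG : G.CliqueFree 3) {v : V}
    (p : G.Walk v v) (hp : p.IsTrail) (hlen : p.length ≠ 0) :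
    SparseOnTriples fun i : ZMod p.length => p.getVert i.val := by
  classical
  have : NeZero p.length := ⟨hlen⟩
  have hsucc : ∀ i : ZMod p.length, p.getVert (i + 1).val = p.getVert (i.val + 1) := by
    intro i
    have hval : (i + 1).val = (i.val + 1) % p.length := by
      rw [← ZMod.val_natCast, Nat.cast_add, ZMod.natCast_zmod_val, Nat.cast_one]
    rcases (show i.val + 1 ≤ p.length from i.val_lt).lt_or_eq with h | h
    · rw [hval, Nat.mod_eq_of_lt h]
    · rw [hval, h, Nat.mod_self, Walk.getVert_zero, Walk.getVert_length]
  intro S hS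
  simp only [hsucc]
  let E : ZMod p.length → Sym2 V := fun i => s(p.getVert i.val, p.getVert (i.val + 1))
  have hE : ∀ i : ZMod p.length, ∃ h : i.val < p.edges.length, p.edges[i.val] = E i := by
    intro i
    refine ⟨by simpa using i.val_lt, ?_⟩
    simp [E, Walk.edges, Walk.darts_getElem_eq_getVert, SimpleGraph.Dart.edge]
  have hEinj : Function.Injective E := by
    intro i j hij
    obtain ⟨hi, hi'⟩ := hE i
    obtain ⟨hj, hj'⟩ := hE j
    refine ZMod.val_injective _ ((hp.edges_nodup.getElem_inj_iff (hi := hi) (hj := hj)).1 ?_)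
    rw [hi', hj', hij]
  have hadj : ∀ i : ZMod p.length, G.Adj (p.getVert i.val) (p.getVert (i.val + 1)) :=
    fun i => p.adj_getVert_succ i.val_lt
  let A : Finset (ZMod p.length) :=
    Finset.univ.filter fun i => p.getVert i.val ∈ S ∧ p.getVert (i.val + 1) ∈ S
  have hA : {i : ZMod p.length | p.getVert i.val ∈ S ∧ p.getVert (i.val + 1) ∈ S} = A := by
    ext i; simp [A]
  rw [hA, Set.ncard_coe_finset, ← Finset.card_image_of_injective A hEinj]
  have hsub : A.image E ⊆ S.offDiag.image Sym2.mk.uncurry := by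
    intro x hx
    obtain ⟨i, hi, rfl⟩ := Finset.mem_image.1 hx
    have hi := (Finset.mem_filter.1 hi).2
    exact Finset.mem_image.2 ⟨(_, _), Finset.mem_offDiag.2 ⟨hi.1, hi.2, (hadj i).ne⟩, rfl⟩
  have hcard : (S.offDiag.image Sym2.mk.uncurry).card = S.card.choose 2 :=
    Sym2.card_image_offDiag S
  have hle := Finset.card_le_card hsub
  rw [hcard] at hle
  by_contra! hlt
  have hS3 : S.card = 3 := by
    by_contra hne
    have : S.card.choose 2 ≤ Nat.choose 2 2 := Nat.choose_le_choose 2 (by omega)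
    simp at this
    omega
  rw [hS3] at hle hcard
  -- All three pairs of points of `S` are edges of the trail, so `S` is a triangle.
  have heq : A.image E = S.offDiag.image Sym2.mk.uncurry :=
    Finset.eq_of_subset_of_card_le hsub (by rw [hcard]; simp; omega)
  refine hG S ⟨fun x hx y hy hxy => ?_, hS3⟩
  have hmem : s(x, y) ∈ A.image E := by
    rw [heq]
    exact Finset.mem_image.2 ⟨(x, y), Finset.mem_offDiag.2 ⟨hx, hy, hxy⟩, rfl⟩
  obtain ⟨i, -, hi⟩ := Finset.mem_image.1 hmem
  rw [← SimpleGraph.mem_edgeSet, ← hi]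
  exact hadj i

/-- A closed trail of length at least one in a triangle-free graph becomes a closed trail in a
triangle-free graph on one more vertex when its first edge is replaced by a path through a new
vertex; the first edge is deleted, so no triangle arises. -/
lemma exists_subdivided_trail {V : Type*} {G : SimpleGraph V} (hG : G.CliqueFree 3) {v : V}
    (p : G.Walk v v) (hp : p.IsTrail) (hlen : p.length ≠ 0) :
    ∃ (H : SimpleGraph (Option V)) (q : H.Walk (some v) (some v)), H.CliqueFree 3 ∧ q.IsTrail ∧
      q.length = p.length + 1 ∧ ∀ x, some x ∈ q.support → x ∈ p.support := by
  classical
  cases p with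
  | nil => simp at hlen
  | @cons _ y _ hvy p =>
    obtain ⟨hp, hnot⟩ := (Walk.isTrail_cons _ _).1 hp
    let K := (G.deleteEdges {s(v, y)}).map (Function.Embedding.some (α := V))
    let H : SimpleGraph (Option V) := K ⊔ edge none (some v) ⊔ edge none (some y)
    have hsome : ∀ a b, H.Adj (some a) (some b) ↔ G.Adj a b ∧ s(a, b) ≠ s(v, y) := by
      intro a b
      have := SimpleGraph.map_adj_apply (G := G.deleteEdges {s(v, y)})
        (f := Function.Embedding.some (α := V)) (a := a) (b := b)
      simpa [H, K, edge_adj] using this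
    have hnone : ∀ a, H.Adj none (some a) ↔ a = v ∨ a = y := by
      intro a
      have hK : ¬ K.Adj none (some a) := by
        rw [SimpleGraph.map_adj]
        simp
      simp [H, hK, edge_adj, eq_comm]
    let f : G.deleteEdges {s(v, y)} →g H := ⟨some, fun {a b} h => by
      rw [deleteEdges_adj] at h
      exact (hsome a b).2 ⟨h.1, by simpa using h.2⟩⟩
    have hf : Function.Injective f := Option.some_injective V
    have hp' : ∀ e ∈ p.edges, e ∉ ({s(v, y)} : Set (Sym2 V)) := by
      rintro e he rfl
      exact hnot he
    let r := (p.toDeleteEdges {s(v, y)} hp').map f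
    have hr : r.IsTrail := by
      rw [Walk.isTrail_map_iff_of_injective hf]
      rw [Walk.isTrail_def, Walk.toDeleteEdges, Walk.edges_transfer]
      exact hp.edges_nodup
    have hrn : none ∉ r.support := by simp [r, f]
    have hrs : ∀ x, some x ∈ r.support → x ∈ p.support := by
      intro x hx
      simpa [r, f] using hx
    have h₁ : H.Adj (some v) none := ((hnone v).2 (.inl rfl)).symm
    have h₂ : H.Adj none (some y) := (hnone y).2 (.inr rfl)
    refine ⟨H, Walk.cons h₁ (Walk.cons h₂ r), ?_, ?_, ?_, ?_⟩
    · intro s hs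
      obtain ⟨a, b, c, hab, hac, hbc, -⟩ := is3Clique_iff.1 hs
      have key : ∀ a b, H.Adj none a → H.Adj none b → ¬ H.Adj a b := by
        rintro (_ | a) (_ | b) ha hb hab
        · exact hab.ne rfl
        · exact ha.ne rfl
        · exact hb.ne rfl
        · rw [hsome] at hab
          rw [hnone] at ha hb
          have := hab.1.ne
          rcases ha with rfl | rfl <;> rcases hb with rfl | rfl
          · exact this rfl
          · exact hab.2 rfl
          · exact hab.2 Sym2.eq_swap
          · exact this rfl
      rcases a with _ | a
      · exact key _ _ hab hac hbc
      rcases b with _ | b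
      · exact key _ _ hab.symm hbc hac
      rcases c with _ | c
      · exact key _ _ hac.symm hbc.symm hab
      rw [hsome] at hab hac hbc
      exact hG {a, b, c} (is3Clique_iff.2 ⟨a, b, c, hab.1, hac.1, hbc.1, rfl⟩)
    · rw [Walk.isTrail_cons, Walk.isTrail_cons]
      refine ⟨⟨hr, fun h => hrn (Walk.fst_mem_support_of_mem_edges _ h)⟩, ?_⟩
      rw [Walk.edges_cons, List.mem_cons, not_or]
      refine ⟨?_, fun h => hrn (Walk.snd_mem_support_of_mem_edges _ h)⟩
      have := hvy.ne
      simp [this]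
    · simp [r, Walk.toDeleteEdges]
    · intro x hx
      simp only [Walk.support_cons, List.mem_cons] at hx ⊢
      rcases hx with h | h | h
      · exact .inl (Option.some_injective _ h)
      · simp at h
      · exact .inr (hrs x h)

/-- Two closed trails without a common edge that share a vertex are spliced into one. -/
lemma exists_spliced_trail {V : Type*} {G : SimpleGraph V} {u v : V} (p : G.Walk u u)
    (q : G.Walk v v) (hp : p.IsTrail) (hq : q.IsTrail) (hv : v ∈ p.support)
    (hpq : p.edges.Disjoint q.edges) :
    ∃ r : G.Walk u u, r.IsTrail ∧ r.length = p.length + q.length ∧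
      (∀ x, x ∈ r.support ↔ x ∈ p.support ∨ x ∈ q.support) ∧
      ∀ e, e ∈ r.edges ↔ e ∈ p.edges ∨ e ∈ q.edges := by
  classical
  obtain ⟨p₁, p₂, rfl⟩ := Walk.mem_support_iff_exists_append.1 hv
  rw [Walk.isTrail_append] at hp
  rw [Walk.edges_append, List.disjoint_append_left] at hpq
  refine ⟨p₁.append (q.append p₂), ?_, ?_, ?_, ?_⟩
  · rw [Walk.isTrail_append, Walk.isTrail_append, Walk.edges_append, List.disjoint_append_right]
    exact ⟨hp.1, ⟨hq, hp.2.1, hpq.2.symm⟩, hpq.1, hp.2.2⟩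
  · simp only [Walk.length_append]; omega
  · intro x
    simp only [Walk.mem_support_append_iff]
    tauto
  · intro e
    simp only [Walk.edges_append, List.mem_append]
    tauto

/-! ### Closed trails in complete bipartite graphs -/

/-- There is a closed trail of length `n` through `inl 0` in the complete bipartite graph with
parts `{0, …, a - 1}` and `{0, …, c - 1}`. -/
def HasBipartiteTrail (a c n : ℕ) : Prop :=
  ∃ p : (completeBipartiteGraph ℕ ℕ).Walk (.inl 0) (.inl 0), p.IsTrail ∧ p.length = n ∧
    ∀ x ∈ p.support, x ∈ (Finset.range a).disjSum (Finset.range c)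

lemma adj_inl_inr (x y : ℕ) : (completeBipartiteGraph ℕ ℕ).Adj (.inl x) (.inr y) := by simp

lemma adj_inr_inl (x y : ℕ) : (completeBipartiteGraph ℕ ℕ).Adj (.inr y) (.inl x) := by simp

/-- The `4`-cycle on the vertices `x, x'` of the left part and `y, y'` of the right part. -/
def fourCycle (x x' y y' : ℕ) : (completeBipartiteGraph ℕ ℕ).Walk (.inl x) (.inl x) :=
  .cons (adj_inl_inr x y) <| .cons (adj_inr_inl x' y) <| .cons (adj_inl_inr x' y') <|
    .cons (adj_inr_inl x y') .nil

/-- The `4`-cycle `fourCycle x x' y y'`, started on the right. -/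
def fourCycle' (x x' y y' : ℕ) : (completeBipartiteGraph ℕ ℕ).Walk (.inr y) (.inr y) :=
  .cons (adj_inr_inl x y) <| .cons (adj_inl_inr x y') <| .cons (adj_inr_inl x' y') <|
    .cons (adj_inl_inr x' y) .nil

/-- The `6`-cycle on the vertices `xᵢ` of the left part and `yᵢ` of the right part. -/
def sixCycle (x₁ x₂ x₃ y₁ y₂ y₃ : ℕ) : (completeBipartiteGraph ℕ ℕ).Walk (.inl x₁) (.inl x₁) :=
  .cons (adj_inl_inr x₁ y₁) <| .cons (adj_inr_inl x₂ y₁) <| .cons (adj_inl_inr x₂ y₂) <|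
    .cons (adj_inr_inl x₃ y₂) <| .cons (adj_inl_inr x₃ y₃) <| .cons (adj_inr_inl x₁ y₃) .nil

/-- A closed trail absorbs the `2 × 2` block `{2i, 2i + 1} × {2j, 2j + 1}` if it uses no edge of
the block but visits its first row or its first column. -/
lemma exists_trail_absorbing_block {u : ℕ ⊕ ℕ} {i j : ℕ}
    (p : (completeBipartiteGraph ℕ ℕ).Walk u u) (hp : p.IsTrail)
    (hedge : ∀ x y, s(.inl x, .inr y) ∈ p.edges → (x / 2, y / 2) ≠ (i, j))
    (hvisit : .inl (2 * i) ∈ p.support ∨ .inr (2 * j) ∈ p.support) :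
    ∃ r : (completeBipartiteGraph ℕ ℕ).Walk u u, r.IsTrail ∧ r.length = p.length + 4 ∧
      (∀ x, x ∈ r.support ↔ x ∈ p.support ∨ x = .inl (2 * i) ∨ x = .inl (2 * i + 1) ∨
        x = .inr (2 * j) ∨ x = .inr (2 * j + 1)) ∧
      ∀ x y, s(.inl x, .inr y) ∈ r.edges →
        s(.inl x, .inr y) ∈ p.edges ∨ (x / 2, y / 2) = (i, j) := by
  have key : ∀ v (q : (completeBipartiteGraph ℕ ℕ).Walk v v), q.IsTrail → q.length = 4 →
      v ∈ p.support →
      (∀ e ∈ q.edges, ∃ x y, e = s(.inl x, .inr y) ∧ (x / 2, y / 2) = (i, j)) →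
      (∀ x, x ∈ q.support ↔ x = .inl (2 * i) ∨ x = .inl (2 * i + 1) ∨
        x = .inr (2 * j) ∨ x = .inr (2 * j + 1)) →
      ∃ r : (completeBipartiteGraph ℕ ℕ).Walk u u, r.IsTrail ∧ r.length = p.length + 4 ∧
        (∀ x, x ∈ r.support ↔ x ∈ p.support ∨ x = .inl (2 * i) ∨ x = .inl (2 * i + 1) ∨
          x = .inr (2 * j) ∨ x = .inr (2 * j + 1)) ∧
        ∀ x y, s(.inl x, .inr y) ∈ r.edges →
          s(.inl x, .inr y) ∈ p.edges ∨ (x / 2, y / 2) = (i, j) := by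
    intro v q hq hqlen hv hqe hqs
    have hdisj : p.edges.Disjoint q.edges := by
      intro e hep heq
      obtain ⟨x, y, rfl, hxy⟩ := hqe e heq
      exact hedge x y hep hxy
    obtain ⟨r, hr, hlen, hs, he⟩ := exists_spliced_trail p q hp hq hv hdisj
    refine ⟨r, hr, by omega, fun x => by rw [hs, hqs], fun x y hxy => ?_⟩
    refine ((he _).1 hxy).imp id fun h => ?_
    obtain ⟨x', y', h', hxy'⟩ := hqe _ h
    simp only [Sym2.eq_iff, Sum.inl.injEq, Sum.inr.injEq, reduceCtorEq, and_false,
      or_false] at h'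
    rw [h'.1, h'.2, hxy']
  have h2 : ∀ m, (2 * m + 1) / 2 = m := fun m => by omega
  rcases hvisit with hi | hj
  · refine key _ (fourCycle (2 * i) (2 * i + 1) (2 * j) (2 * j + 1)) ?_ rfl hi ?_ ?_
    · simp [fourCycle, Walk.isTrail_def]
    · intro e he
      simp only [fourCycle, Walk.edges_cons, Walk.edges_nil, List.mem_cons, List.not_mem_nil,
        or_false] at he
      rcases he with rfl | rfl | rfl | rfl
      · exact ⟨2 * i, 2 * j, rfl, by simp⟩
      · exact ⟨2 * i + 1, 2 * j, Sym2.eq_swap, by simp [h2]⟩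
      · exact ⟨2 * i + 1, 2 * j + 1, rfl, by simp [h2]⟩
      · exact ⟨2 * i, 2 * j + 1, Sym2.eq_swap, by simp [h2]⟩
    · intro x; simp [fourCycle]; tauto
  · refine key _ (fourCycle' (2 * i) (2 * i + 1) (2 * j) (2 * j + 1)) ?_ rfl hj ?_ ?_
    · simp [fourCycle', Walk.isTrail_def]
    · intro e he
      simp only [fourCycle', Walk.edges_cons, Walk.edges_nil, List.mem_cons, List.not_mem_nil,
        or_false] at he
      rcases he with rfl | rfl | rfl | rfl
      · exact ⟨2 * i, 2 * j, Sym2.eq_swap, by simp⟩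
      · exact ⟨2 * i, 2 * j + 1, rfl, by simp [h2]⟩
      · exact ⟨2 * i + 1, 2 * j + 1, Sym2.eq_swap, by simp [h2]⟩
      · exact ⟨2 * i + 1, 2 * j, rfl, by simp [h2]⟩
    · intro x; simp [fourCycle']; tauto

/-- Let `R` be a set of `2 × 2` blocks `{2i, 2i + 1} × {2j, 2j + 1}` within an `a × c` grid whose
edges are not used by the closed trail `p`. If in each column of blocks that meets `R` either the
top block is in `R` or `p` visits that column, then `p` can be extended by any number of
blocks of `R`: a top block touches `p` at `inl 0`, and once it is absorbed
so does any other block of its column. -/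
lemma hasBipartiteTrail_add_blocks {a c : ℕ} (k : ℕ) :
    ∀ (R : Finset (ℕ × ℕ)) (p : (completeBipartiteGraph ℕ ℕ).Walk (.inl 0) (.inl 0)),
      k ≤ R.card → p.IsTrail →
      (∀ x ∈ p.support, x ∈ (Finset.range a).disjSum (Finset.range c)) →
      (∀ b ∈ R, 2 * b.1 + 1 < a ∧ 2 * b.2 + 1 < c) →
      (∀ x y, s(.inl x, .inr y) ∈ p.edges → (x / 2, y / 2) ∉ R) →
      (∀ b ∈ R, (0, b.2) ∈ R ∨ .inr (2 * b.2) ∈ p.support) →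
      HasBipartiteTrail a c (p.length + 4 * k) := by
  classical
  induction k with
  | zero => exact fun R p _ hp hsup _ _ _ => ⟨p, hp, rfl, hsup⟩
  | succ k ih =>
    intro R p hk hp hsup hR hedge hcol
    obtain ⟨i, j, hij, hne⟩ : ∃ i j, (i, j) ∈ R ∧ (i = 0 ∨ .inr (2 * j) ∈ p.support) := by
      obtain ⟨b, hb⟩ := Finset.card_pos.1 (show 0 < R.card by omega)
      rcases hcol b hb with h | h
      · exact ⟨0, b.2, h, .inl rfl⟩
      · exact ⟨b.1, b.2, hb, .inr h⟩
    obtain ⟨r, hr, hrlen, hrsup, hrR⟩ := exists_trail_absorbing_block (i := i) (j := j) p hp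
      (fun x y hxy h => hedge x y hxy (h ▸ hij))
      (hne.imp_left fun h => by rw [h]; exact p.start_mem_support)
    have hrj : .inr (2 * j) ∈ r.support := (hrsup _).2 (by simp)
    have hlen : p.length + 4 * (k + 1) = r.length + 4 * k := by omega
    rw [hlen]
    refine ih (R.erase (i, j)) r (by rw [Finset.card_erase_of_mem hij]; omega) hr ?_ ?_ ?_ ?_
    · intro x hx
      have := hR _ hij
      rcases (hrsup x).1 hx with h | rfl | rfl | rfl | rfl
      · exact hsup x h
      all_goals simp; omega
    · exact fun b hb => hR b (Finset.mem_of_mem_erase hb)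
    · intro x y hxy h
      rw [Finset.mem_erase] at h
      rcases hrR x y hxy with h' | h'
      · exact hedge x y h' h.2
      · exact h.1 h'
    · intro b hb
      by_cases hbj : b.2 = j
      · exact .inr (hbj ▸ hrj)
      · refine (hcol b (Finset.mem_of_mem_erase hb)).imp (fun h => ?_)
          fun h => (hrsup _).2 (.inl h)
        exact Finset.mem_erase.2 ⟨fun h' => hbj (Prod.mk.inj h').2, h⟩

/-- The blocks of a `2A × 2B` grid, the block in the corner serving as the first `4`-cycle. -/
lemma hasBipartiteTrail_four_mul {A B k : ℕ} (hA : 1 ≤ A) (hB : 1 ≤ B) (hk : k < A * B) :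
    HasBipartiteTrail (2 * A) (2 * B) (4 + 4 * k) := by
  refine hasBipartiteTrail_add_blocks k ((Finset.range A ×ˢ Finset.range B).erase (0, 0))
    (fourCycle 0 1 0 1) ?_ ?_ ?_ ?_ ?_ ?_
  · rw [Finset.card_erase_of_mem (by simp; omega)]
    simp
    omega
  · simp [fourCycle, Walk.isTrail_def]
  · simp [fourCycle]; omega
  · rintro ⟨i, j⟩ h
    simp at h
    omega
  · intro x y h
    simp [fourCycle] at h
    simp
    omega
  · rintro ⟨i, j⟩ h
    simp [fourCycle] at h ⊢
    omega

/-- With one more vertex on the right, a `6`-cycle through it takes the place of two blocks. -/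
lemma hasBipartiteTrail_six_add {A B k : ℕ} (hA : 2 ≤ A) (hB : 1 ≤ B) (hk : k + 2 ≤ A * B) :
    HasBipartiteTrail (2 * A) (2 * B + 1) (6 + 4 * k) := by
  refine hasBipartiteTrail_add_blocks k
    (Finset.range A ×ˢ Finset.range B \ Finset.range 2 ×ˢ Finset.range 1)
    (sixCycle 0 2 3 0 1 (2 * B)) ?_ ?_ ?_ ?_ ?_ ?_
  · rw [Finset.card_sdiff_of_subset]
    · simp; omega
    · exact Finset.product_subset_product (by simpa) (by simpa)
  · simp [sixCycle, Walk.isTrail_def]; omega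
  · simp [sixCycle]; omega
  · rintro ⟨i, j⟩ h
    simp at h
    omega
  · intro x y h
    simp [sixCycle] at h
    simp
    omega
  · rintro ⟨i, j⟩ h
    simp [sixCycle] at h ⊢
    omega

/-- The first `10` edges lie in the four corner blocks: they are what a `6`-cycle leaves of the
complete bipartite graph with parts of size `4`. -/
lemma hasBipartiteTrail_ten_add {A B k : ℕ} (hA : 2 ≤ A) (hB : 2 ≤ B) (hk : k + 4 ≤ A * B) :
    HasBipartiteTrail (2 * A) (2 * B) (10 + 4 * k) := by
  refine hasBipartiteTrail_add_blocks k
    (Finset.range A ×ˢ Finset.range B \ Finset.range 2 ×ˢ Finset.range 2)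
    ((fourCycle 0 1 0 1).append (sixCycle 0 2 3 2 0 3)) ?_ ?_ ?_ ?_ ?_ ?_
  · rw [Finset.card_sdiff_of_subset]
    · simp; omega
    · exact Finset.product_subset_product (by simpa) (by simpa)
  · simp [fourCycle, sixCycle, Walk.isTrail_def]
  · simp [sixCycle, fourCycle]; omega
  · rintro ⟨i, j⟩ h
    simp at h
    omega
  · intro x y h
    simp [sixCycle, fourCycle] at h
    simp
    omega
  · rintro ⟨i, j⟩ h
    simp [sixCycle, fourCycle] at h ⊢
    omega

lemma hasBipartiteTrail_six : HasBipartiteTrail 3 3 6 :=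
  ⟨sixCycle 0 1 2 0 1 2, by simp [sixCycle, Walk.isTrail_def], rfl, by simp [sixCycle]⟩

/-! ### Lengths of symbol-pair codes -/

/-- A closed trail of length `n` on `a + c ≤ q + 1` vertices yields a code of length `n`. -/
lemma HasBipartiteTrail.exists_code {a c q n : ℕ} (h : HasBipartiteTrail a c n)
    (hq : IsPrimePow q) {α : Type*} (hα : Nat.card α = q) (hn : 4 ≤ n) (hac : a + c ≤ q + 1) :
    ∃ C : Set (ZMod n → α), IsMDSSymbolPairCode C (n - 2) := by
  obtain ⟨p, hp, rfl, hsup⟩ := h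
  have hfree : (completeBipartiteGraph ℕ ℕ).CliqueFree 3 :=
    (CompleteBipartiteGraph.bicoloring ℕ ℕ).colorable.cliqueFree (by simp)
  exact exists_isMDSSymbolPairCode_of_isPrimePow hq hα hn
    (sparseOnTriples_getVert hfree p hp (by omega))
    (fun i => hsup _ (p.getVert_mem_support _)) (by simpa using hac)

/-- A closed trail of length `n` on `a + c ≤ q` vertices yields a code of length `n + 1`, one of
its edges being subdivided by a further vertex. -/
lemma HasBipartiteTrail.exists_code_succ {a c q n : ℕ} (h : HasBipartiteTrail a c n)
    (hq : IsPrimePow q) {α : Type*} (hα : Nat.card α = q) (hn : 4 ≤ n) (hac : a + c ≤ q) :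
    ∃ C : Set (ZMod (n + 1) → α), IsMDSSymbolPairCode C (n + 1 - 2) := by
  obtain ⟨p, hp, rfl, hsup⟩ := h
  have hfree : (completeBipartiteGraph ℕ ℕ).CliqueFree 3 :=
    (CompleteBipartiteGraph.bicoloring ℕ ℕ).colorable.cliqueFree (by simp)
  obtain ⟨H, r, hH, hr, hlen, hrs⟩ := exists_subdivided_trail hfree p hp (by omega)
  rw [← hlen]
  refine exists_isMDSSymbolPairCode_of_isPrimePow hq hα (by omega)
    (sparseOnTriples_getVert hH r hr (by omega))
    (T := Finset.insertNone ((Finset.range a).disjSum (Finset.range c))) (fun i => ?_) ?_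
  · rw [Finset.mem_insertNone]
    exact fun x hx => hsup x (hrs x (hx ▸ r.getVert_mem_support _))
  · simpa using hac

/-- For even `m = 2r`, the size bound is the number of edges of a complete bipartite graph whose
parts are even, as equal as possible, and have `m` vertices altogether. -/
lemma exists_eulerianSizeBound_two_mul (r : ℕ) :
    ∃ A B, A + B = r ∧ B ≤ A ∧ A ≤ B + 1 ∧ eulerianSizeBound (2 * r) = 4 * (A * B) := by
  have hM : eulerianSizeBound (2 * r) = 2 * (r ^ 2 / 2) := by
    rw [eulerianSizeBound, if_pos (even_two_mul r), mul_pow,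
      show 2 ^ 2 * r ^ 2 / 8 = r ^ 2 / 2 by omega]
  rw [hM]
  obtain ⟨s, rfl | rfl⟩ := Nat.even_or_odd' r
  · refine ⟨s, s, by omega, le_rfl, by omega, ?_⟩
    rw [show (2 * s) ^ 2 = 4 * (s * s) by ring]
    omega
  · refine ⟨s + 1, s, by omega, by omega, le_rfl, ?_⟩
    rw [show (2 * s + 1) ^ 2 = 4 * ((s + 1) * s) + 1 by ring]
    omega

lemma eulerianSizeBound_two_mul_add_one (r : ℕ) :
    eulerianSizeBound (2 * r + 1) = eulerianSizeBound (2 * r) + 1 := by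
  simp [eulerianSizeBound]

/-- For odd `q` the parts are as equal as possible, with `q + 1` vertices if `n` is even and `q - 1`
if `n` is odd; only `n = 6` uses a `6`-cycle instead, as for `q = 5` it does not fit into parts of
sizes `4` and `2`. If `n` is odd, one additional vertex subdivides an edge, and another one is
needed if `n ≡ 3 [MOD 4]`. -/
lemma exists_code_of_odd {q : ℕ} (hq : IsPrimePow q) (hq5 : 5 ≤ q) {α : Type*}
    (hα : Nat.card α = q) {n : ℕ} (hn : 4 ≤ n) (hodd : Odd q)
    (h : n ≤ eulerianSizeBound q + 1 ∨
        (eulerianSizeBound q + 1 ≤ n ∧ n ≤ eulerianSizeBound (q + 1) ∧ Even n ∧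
          n ≠ eulerianSizeBound (q + 1) - 2)) :
    ∃ C : Set (ZMod n → α), IsMDSSymbolPairCode C (n - 2) := by
  obtain ⟨r, hr⟩ := hodd
  obtain ⟨A, B, hAB, hBA, hAB', hM⟩ := exists_eulerianSizeBound_two_mul r
  obtain ⟨A', B', hAB₁, hBA₁, hAB₁', hM'⟩ := exists_eulerianSizeBound_two_mul (r + 1)
  obtain rfl : A' = B + 1 := by omega
  obtain rfl : B' = A := by omega
  rw [show q + 1 = 2 * (r + 1) by omega, hM', hr, eulerianSizeBound_two_mul_add_one, hM,
    add_mul, one_mul, mul_comm B] at h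
  -- `P` is the number of blocks in the grid of `q - 1` vertices.
  generalize hP : B' * B = P at h
  have hA1 : 1 ≤ B' := by omega
  have hB1 : 1 ≤ B := by omega
  have hA2 : 2 ≤ P → 2 ≤ B' := by
    intro hP2
    by_contra hlt
    obtain rfl : B' = 1 := by omega
    omega
  obtain ⟨k, hk⟩ : ∃ k, n = 4 + 4 * k ∨ n = 5 + 4 * k ∨ n = 6 + 4 * k ∨ n = 7 + 4 * k :=
    ⟨(n - 4) / 4, by omega⟩
  rcases hk with rfl | rfl | rfl | rfl
  · refine (hasBipartiteTrail_four_mul (A := B + 1) (B := B') (by omega) hA1 ?_).exists_code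
      hq hα hn (by omega)
    rw [add_mul, mul_comm B, hP]
    omega
  · have heven : ¬ Even (5 + 4 * k) := by rw [Nat.even_iff]; omega
    have hk : k < B' * B := by rw [hP]; simp only [heven, false_and, and_false, or_false] at h; omega
    have := (hasBipartiteTrail_four_mul hA1 hB1 hk).exists_code_succ hq hα (by omega) (by omega)
    rwa [show 4 + 4 * k + 1 = 5 + 4 * k by omega] at this
  · rcases k with _ | k
    · exact hasBipartiteTrail_six.exists_code hq hα hn (by omega)
    · rw [show 6 + 4 * (k + 1) = 10 + 4 * k by omega] at *
      have hB'2 : 2 ≤ B' := by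
        by_contra hlt
        obtain rfl : B' = 1 := by omega
        omega
      refine (hasBipartiteTrail_ten_add (A := B + 1) (B := B') (by omega) hB'2 ?_).exists_code
        hq hα hn (by omega)
      rw [add_mul, mul_comm B, hP]
      omega
  · have heven : ¬ Even (7 + 4 * k) := by rw [Nat.even_iff]; omega
    have hk : k + 2 ≤ P := by simp only [heven, false_and, and_false, or_false] at h; omega
    have := (hasBipartiteTrail_six_add (hA2 (by omega)) hB1 (hP ▸ hk)).exists_code_succ hq hα
      (by omega) (by omega)
    rwa [show 6 + 4 * k + 1 = 7 + 4 * k by omega] at this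

/-- For even `q ≥ 8` both parts have `q / 2` vertices. The additional vertex belongs to a `6`-cycle
if `n ≡ 2 [MOD 4]` and subdivides an edge if `n` is odd. -/
lemma exists_code_of_even {q : ℕ} (hq : IsPrimePow q) (hq5 : 5 ≤ q) {α : Type*}
    (hα : Nat.card α = q) {n : ℕ} (hn : 4 ≤ n) (heven : Even q)
    (h : n ≤ q ^ 2 / 4 + 1) (hne : n ≠ q ^ 2 / 4 - 1) :
    ∃ C : Set (ZMod n → α), IsMDSSymbolPairCode C (n - 2) := by
  obtain ⟨s, rfl⟩ : 4 ∣ q := by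
    obtain ⟨p, k, hp, -, rfl⟩ := (isPrimePow_nat_iff q).1 hq
    obtain rfl : p = 2 := by
      have := (Nat.even_pow.1 heven).1
      exact hp.even_iff.1 this
    have hk : 2 ≤ k := by
      by_contra hlt
      have : k = 0 ∨ k = 1 := by omega
      rcases this with rfl | rfl <;> omega
    exact pow_dvd_pow 2 hk
  rw [show (4 * s) ^ 2 / 4 = 4 * (s * s) by
    rw [show (4 * s) ^ 2 = 4 * (4 * (s * s)) by ring, Nat.mul_div_cancel_left _ (by norm_num)]]
    at h hne
  have hs : 2 ≤ s := by omega
  have hs4 : 4 ≤ s * s := Nat.mul_le_mul hs hs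
  obtain ⟨k, hk⟩ : ∃ k, n = 4 + 4 * k ∨ n = 5 + 4 * k ∨ n = 6 + 4 * k ∨ n = 7 + 4 * k :=
    ⟨(n - 4) / 4, by omega⟩
  rcases hk with rfl | rfl | rfl | rfl
  · exact (hasBipartiteTrail_four_mul (by omega) (by omega) (by omega : k < s * s)).exists_code
      hq hα hn (by omega)
  · have := (hasBipartiteTrail_four_mul (by omega) (by omega)
      (by omega : k < s * s)).exists_code_succ hq hα (by omega) (by omega)
    rwa [show 4 + 4 * k + 1 = 5 + 4 * k by omega] at this
  · exact (hasBipartiteTrail_six_add hs (by omega) (by omega : k + 2 ≤ s * s)).exists_code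
      hq hα hn (by omega)
  · rcases k with _ | k
    · exact hasBipartiteTrail_six.exists_code_succ hq hα (by omega) (by omega)
    · have := (hasBipartiteTrail_ten_add hs hs (by omega : k + 4 ≤ s * s)).exists_code_succ hq hα
        (by omega) (by omega)
      rwa [show 10 + 4 * k + 1 = 7 + 4 * (k + 1) by omega] at this

theorem mainTheorem5 (q : ℕ) (hq : IsPrimePow q) (hq5 : 5 ≤ q)
    {α : Type*} (hα : Nat.card α = q) (n : ℕ) (hn : 4 ≤ n) :
    (Odd q →
      (n ≤ eulerianSizeBound q + 1 ∨
        (eulerianSizeBound q + 1 ≤ n ∧ n ≤ eulerianSizeBound (q + 1) ∧ Even n ∧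
          n ≠ eulerianSizeBound (q + 1) - 2)) →
      ∃ C : Set (ZMod n → α), IsMDSSymbolPairCode C (n - 2)) ∧
    (Even q →
      n ≤ q ^ 2 / 4 + 1 → n ≠ q ^ 2 / 4 - 1 →
      ∃ C : Set (ZMod n → α), IsMDSSymbolPairCode C (n - 2)) :=
  ⟨exists_code_of_odd hq hq5 hα hn, exists_code_of_even hq hq5 hα hn⟩
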